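/- Let $\mathcal P_2(\mathbb R^d)$ be the set of Borel probability measures on $\mathbb R^d$ with finite second moment, with the 2-Wasserstein distance $W_2$; let $\Gamma_o(\mu,\nu)$ be the set of optimal transport plans for the quadratic cost, and let $\mathrm{Tan}_\mu$ be the closure of $\{\nabla\varphi:\varphi\in C_c^\infty(\mathbb R^d)\}$ in $L^2(\mu)^d$. A vector field $\xi\in\mathrm{Tan}_\mu$ is the Wasserstein gradient at $\mu$ of $\Phi:\mathcal P_2(\mathbb R^d)\to\mathbb R$ if, as $W_2(\mu,\nu)\to0$, $$\Phi(\nu)-\Phi(\mu)=\int\langle \xi(x),y-x\rangle\,\gamma(\mathrm dx\,\mathrm dy)+O\big(W_2(\mu,\nu)^2\big)\qquad\text{for all }\gamma\in\Gamma_o(\mu,\nu).$$ Call $F:\mathcal P_2(\mathbb R^d)\to\mathbb R$ sufficiently smooth, with gradient $\nabla_\mu F:\mathcal P_2(\mathbb R^d)\times\mathbb R^d\to\mathbb R^d$ and Hessian kernel $\nabla_\mu^2F:\mathcal P_2(\mathbb R^d)\times\mathbb R^d\times\mathbb R^d\to\mathbb R^{d\times d}$, if for every $\mu\in\mathcal P_2(\mathbb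 R^d)$: 1. $\nabla_\mu F(\mu,\cdot)$ is the Wasserstein gradient of $F$ at $\mu$; 2. for every $x\in\mathbb R^d$ and $i\le d$, the $i$-th row of $\nabla_\mu^2F(\mu,x,\cdot)$ is the Wasserstein gradient at $\mu$ of $\nu\mapsto(\nabla_\mu F(\nu,x))_i$, where there are $r>0$ and a continuous $c\in L^2(\mu)$ such that the error is at most $c(x)\,W_2(\mu,\nu)^2$ for all $x$, $i$ and all $\nu$ with $W_2(\mu,\nu)<r$; 3. $\nabla_\mu F(\mu,\cdot)$ is of class $C^1$ on $\mathbb R^d$, and its derivative $\nabla\nabla_\mu F(\mu,\cdot)$ is $\mu$-essentially bounded; 4. $\nabla_\mu^2F(\mu,\cdot,\cdot)\in L^2(\mu\otimes\mu)$. Let $F$ be sufficiently smooth, and let $\mu^*\in\mathcal P_2(\mathbb R^d)$ be absolutely continuous with respect to Lebesgue measure and a $W_2$-local minimum of $F$, i.e. there is $r>0$ such that $F(\mu^*)\le F(\mu)$ whenever $W_2(\mu,\mu^*)<r$. Then $$H_{\mu^*}f(x)=\int\nabla_\mu^2F(\mu^*,x,y)\,f(y)\,\mu^*(\mathrm dy)$$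 defines a bounded linear operator on $L^2(\mu^*)^d$, and $H_{\mu^*}$ is positive semidefinite: $\langle v,H_{\mu^*}v\rangle_{L^2(\mu^*)}\ge0$ for all $v\in L^2(\mu^*)^d$. -/

import Mathlib

open MeasureTheory
open scoped ENNReal ContDiff RealInnerProductSpace

noncomputable section

namespace WassersteinOpt

/-- `ℝ^d` with its Euclidean norm. -/
abbrev Eu (d : ℕ) : Type := EuclideanSpace ℝ (Fin d)

/-- Borel probability measures on `ℝ^d` with finite second moment. -/
def P2 (d : ℕ) : Type :=
  {μ : Measure (Eu d) // IsProbabilityMeasure μ ∧ ∫⁻ x, ‖x‖ₑ ^ 2 ∂μ < ⊤}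

/-- The underlying measure. -/
abbrev P2.meas {d : ℕ} (μ : P2 d) : Measure (Eu d) := μ.1

instance P2.instIsProbabilityMeasure {d : ℕ} (μ : P2 d) : IsProbabilityMeasure μ.meas := μ.2.1

/-- Transport plans between `μ` and `ν`. -/
def couplings {d : ℕ} (μ ν : P2 d) : Set (Measure (Eu d × Eu d)) :=
  {γ | γ.map Prod.fst = μ.meas ∧ γ.map Prod.snd = ν.meas}

/-- Quadratic cost of a plan. -/
def cost {d : ℕ} (γ : Measure (Eu d × Eu d)) : ℝ≥0∞ := ∫⁻ p, ‖p.1 - p.2‖ₑ ^ 2 ∂γ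

/-- The 2-Wasserstein distance. -/
def W2 {d : ℕ} (μ ν : P2 d) : ℝ := Real.sqrt (⨅ γ ∈ couplings μ ν, cost γ).toReal

/-- Optimal transport plans. -/
def optimalPlans {d : ℕ} (μ ν : P2 d) : Set (Measure (Eu d × Eu d)) :=
  {γ | γ ∈ couplings μ ν ∧ ∀ γ' ∈ couplings μ ν, cost γ ≤ cost γ'}

/-- `ξ` lies in the tangent space at `μ`: the closure in `L²(μ; ℝ^d)` of the gradients of
smooth compactly supported functions. -/
def InTangent {d : ℕ} (μ : P2 d) (ξ : Eu d → Eu d) : Prop :=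
  MemLp ξ 2 μ.meas ∧ ∀ ε : ℝ≥0∞, 0 < ε → ∃ φ : Eu d → ℝ,
    ContDiff ℝ ∞ φ ∧ HasCompactSupport φ ∧ eLpNorm (fun x => ξ x - gradient φ x) 2 μ.meas < ε

/-- `ξ` is the (tangent) Wasserstein gradient at `μ` of the functional `Φ`, where the error is at
most `C * W₂(μ, ν)²` for all `ν` with `W₂(μ, ν) < r`. -/
def IsWGradientWith {d : ℕ} (Φ : P2 d → ℝ) (μ : P2 d) (ξ : Eu d → Eu d) (C r : ℝ) : Prop :=
  InTangent μ ξ ∧ ∀ ν : P2 d, W2 μ ν < r → ∀ γ ∈ optimalPlans μ ν,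
    |Φ ν - Φ μ - ∫ p, ⟪ξ p.1, p.2 - p.1⟫ ∂γ| ≤ C * W2 μ ν ^ 2

/-- `ξ` is the Wasserstein gradient of `Φ` at `μ`:
`Φ(ν) - Φ(μ) = ∫ ⟪ξ(x), y - x⟫ dγ + O(W₂(μ, ν)²)` for optimal plans `γ`, with `ξ` tangent. -/
def IsWGradient {d : ℕ} (Φ : P2 d → ℝ) (μ : P2 d) (ξ : Eu d → Eu d) : Prop :=
  ∃ C r : ℝ, 0 < r ∧ IsWGradientWith Φ μ ξ C r

/-- `F` is sufficiently smooth, with Wasserstein gradient `G μ x = ∇_μ F(μ, x)` and Wasserstein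
Hessian kernel `K μ x y = ∇_μ² F(μ, x, y)`. -/
structure SufficientlySmooth {d : ℕ} (F : P2 d → ℝ) (G : P2 d → Eu d → Eu d)
    (K : P2 d → Eu d → Eu d → Matrix (Fin d) (Fin d) ℝ) : Prop where
  /-- `G μ` is the Wasserstein gradient of `F` at `μ`; it is square integrable, being tangent. -/
  grad : ∀ μ, IsWGradient F μ (G μ)
  /-- For each `x`, the `i`-th component of `ν ↦ G ν x` has at `μ` the Wasserstein gradient
  `y ↦` (`i`-th row of `K μ x y`). The constant in the error `O(W₂²)` may depend on `x`, but is
  locally bounded and square integrable as a function of `x`. -/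
  hess : ∀ μ, ∃ (c : Eu d → ℝ) (r : ℝ), Continuous c ∧ MemLp c 2 μ.meas ∧ 0 < r ∧
    ∀ (x : Eu d) (i : Fin d),
      IsWGradientWith (fun ν => G ν x i) μ (fun y => WithLp.toLp 2 (K μ x y i)) (c x) r
  /-- `G μ` is continuously differentiable in the space variable. -/
  contDiff : ∀ μ, ContDiff ℝ 1 (G μ)
  /-- The kernel is square integrable for `μ ⊗ μ`. -/
  hess_memLp : ∀ μ i j, MemLp (fun p : Eu d × Eu d => K μ p.1 p.2 i j) 2 (μ.meas.prod μ.meas)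
  /-- The spatial derivative of `G μ` is `μ`-essentially bounded. -/
  deriv_bdd : ∀ μ, ∃ M : ℝ, ∀ᵐ x ∂μ.meas, ‖fderiv ℝ (G μ) x‖ ≤ M

/-- `μ` is a local minimum of `F` for the distance `W₂`. -/
def IsW2LocalMin {d : ℕ} (F : P2 d → ℝ) (μ : P2 d) : Prop :=
  ∃ r : ℝ, 0 < r ∧ ∀ ν : P2 d, W2 ν μ < r → F μ ≤ F ν

/-- `T` is the integral operator on `L²(μ; ℝ^d)` with matrix kernel `k`:
`(T f)(x) = ∫ k(x, y) f(y) μ(dy)`. -/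
def IsIntegralOperator {d : ℕ} (μ : P2 d) (k : Eu d → Eu d → Matrix (Fin d) (Fin d) ℝ)
    (T : Lp (Eu d) 2 μ.meas →L[ℝ] Lp (Eu d) 2 μ.meas) : Prop :=
  ∀ f : Lp (Eu d) 2 μ.meas,
    T f =ᵐ[μ.meas] fun x => ∫ y, Matrix.toEuclideanCLM (𝕜 := ℝ) (k x y) (f y) ∂μ.meas

end WassersteinOpt

end

/-!
Displacing `μ` along `∇φ`, for a test function `φ`, gives a curve `μ_s` that is an optimal geodesic
for small `s` of either sign: the solution of the Hamilton–Jacobi equation started at `φ` is a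
Kantorovich potential, as long as `∇φ` does not make trajectories cross. Along the curve `F` is
therefore differentiable, with derivative `∫ ⟪G(μ_s, x + s ∇φ(x)), ∇φ(x)⟫ μ(dx)`, and has a local
minimum at `s = 0`. Hence `G(μ, ·)` is orthogonal to all `∇φ`, so it vanishes `μ`-almost everywhere,
being tangent. As `μ` is absolutely continuous, the spatial derivative of `G(μ, ·)` vanishes almost
everywhere on the zero set as well. The motion of the base point thus contributes nothing to first
order: `G(μ_s, x + s ∇φ(x)) / s` tends to `H ∇φ` in `L²(μ)`, and the second derivative of `F` along
the curve is `⟨∇φ, H ∇φ⟩ ≥ 0`.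

Passing from gradients to arbitrary fields requires that `H` respects the splitting of `L²(μ)` into
the tangent space and its orthogonal complement. The rows of the kernel are tangent, so `H` vanishes
on the complement. Pulled back to `μ`, the tangency of `G(μ_s, ·)` at `μ_s` says that
`G(μ_s, x + s ∇φ(x))` is orthogonal to `n + s D²φ n` for every `n` orthogonal to gradients; dividing
by `s` and letting `s → 0` shows that `H ∇φ` is orthogonal to `n`, hence tangent.
-/

noncomputable section

namespace WassersteinOpt

open Filter Topology
open scoped NNReal

section Gradient

variable {E : Type*} [NormedAddCommGroup E] [InnerProductSpace ℝ E] [CompleteSpace E] {φ : E → ℝ}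

lemma contDiff_gradient {m n : WithTop ℕ∞} (hφ : ContDiff ℝ n φ) (hmn : m + 1 ≤ n) :
    ContDiff ℝ m (gradient φ) :=
  (InnerProductSpace.toDual ℝ E).symm.contDiff.comp (hφ.fderiv_right hmn)

lemma hasCompactSupport_gradient (hφ : HasCompactSupport φ) : HasCompactSupport (gradient φ) :=
  (hφ.fderiv ℝ).comp_left (g := (InnerProductSpace.toDual ℝ E).symm) (map_zero _)

lemma gradient_add {ψ : E → ℝ} (hφ : Differentiable ℝ φ) (hψ : Differentiable ℝ ψ) :
    gradient (φ + ψ) = gradient φ + gradient ψ := by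
  ext1 x
  simp only [gradient, Pi.add_apply, fderiv_add (hφ x) (hψ x), map_add]

lemma gradient_const_smul (hφ : Differentiable ℝ φ) (a : ℝ) :
    gradient (a • φ) = a • gradient φ := by
  ext1 x
  simp only [gradient, Pi.smul_apply, fderiv_const_smul (hφ x), map_smul]

lemma inner_gradient_comp {S : E → E} {x : E} (hφ : DifferentiableAt ℝ φ (S x))
    (hS : DifferentiableAt ℝ S x) (v : E) :
    ⟪gradient (φ ∘ S) x, v⟫ = ⟪gradient φ (S x), fderiv ℝ S x v⟫ := by
  simp only [gradient, InnerProductSpace.toDual_symm_apply, fderiv_comp x hφ hS,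
    ContinuousLinearMap.comp_apply]

lemma abs_sub_sub_inner_gradient_le {L : ℝ≥0} (hφ : Differentiable ℝ φ)
    (hL : LipschitzWith L (gradient φ)) (x z : E) :
    |φ x - φ z - ⟪gradient φ z, x - z⟫| ≤ L * ‖x - z‖ ^ 2 := by
  have hbound : ∀ y ∈ Metric.closedBall z ‖x - z‖,
      ‖fderiv ℝ φ y - fderiv ℝ φ z‖ ≤ L * ‖x - z‖ := fun y hy => by
    rw [← toDual_gradient, ← toDual_gradient, ← map_sub, LinearIsometryEquiv.norm_map]
    exact (hL.norm_sub_le y z).trans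
      (mul_le_mul_of_nonneg_left (mem_closedBall_iff_norm.1 hy) L.2)
  have hmean := (convex_closedBall z ‖x - z‖).norm_image_sub_le_of_norm_fderiv_le'
    (fun y _ => hφ y) hbound (Metric.mem_closedBall_self (norm_nonneg _))
    (mem_closedBall_iff_norm.2 le_rfl)
  rwa [mul_assoc, ← sq, Real.norm_eq_abs, ← toDual_gradient,
    InnerProductSpace.toDual_apply_apply] at hmean

end Gradient

section Displacement

variable {E : Type*} [NormedAddCommGroup E] [NormedSpace ℝ E] {X : E → E}

/-- Time `s` of the flow that moves each point `x` along the straight line with velocity `X x`. -/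
def displacement (X : E → E) (s : ℝ) (x : E) : E := x + s • X x

lemma displacement_zero : displacement X 0 = id := by
  ext1 x
  simp [displacement]

lemma displacement_sub_displacement (s t : ℝ) (x : E) :
    displacement X t x - displacement X s x = (t - s) • X x := by
  simp only [displacement]
  module

lemma displacement_apply_sub (s : ℝ) (x z : E) :
    displacement X s x - displacement X s z = (x - z) + s • (X x - X z) := by
  simp only [displacement]
  module

lemma continuous_displacement (hX : Continuous X) : Continuous (displacement X).uncurry :=
  continuous_snd.add (continuous_fst.smul (hX.comp continuous_snd))

lemma hasFDerivAt_displacement {x : E} (hX : DifferentiableAt ℝ X x) (s : ℝ) :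
    HasFDerivAt (displacement X s) (ContinuousLinearMap.id ℝ E + s • fderiv ℝ X x) x :=
  (hasFDerivAt_id x).add (hX.hasFDerivAt.const_smul s)

lemma contDiff_displacement {n : WithTop ℕ∞} (hX : ContDiff ℝ n X) (s : ℝ) :
    ContDiff ℝ n (displacement X s) :=
  contDiff_id.add (hX.const_smul s)

lemma mul_norm_sub_le_norm_displacement_sub {L : ℝ≥0} (hL : LipschitzWith L X)
    (s : ℝ) (x z : E) : (1 - |s| * L) * ‖x - z‖ ≤ ‖displacement X s x - displacement X s z‖ := by
  have hle : ‖s • (X x - X z)‖ ≤ |s| * (L * ‖x - z‖) := by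
    rw [norm_smul, Real.norm_eq_abs]
    exact mul_le_mul_of_nonneg_left (hL.norm_sub_le x z) (abs_nonneg s)
  rw [displacement_apply_sub]
  linarith [norm_sub_le_norm_add (x - z) (s • (X x - X z))]

lemma measurableEmbedding_displacement [MeasurableSpace E] [BorelSpace E] [PolishSpace E]
    {L : ℝ≥0} (hL : LipschitzWith L X) {s : ℝ} (hs : |s| * L < 1) :
    MeasurableEmbedding (displacement X s) := by
  refine ((continuous_displacement hL.continuous).uncurry_left s).measurableEmbedding
    fun x z hxz => ?_
  have h := mul_norm_sub_le_norm_displacement_sub hL s x z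
  rw [hxz, sub_self, norm_zero] at h
  exact sub_eq_zero.1 (norm_le_zero_iff.1 (nonpos_of_mul_nonpos_right h (sub_pos.2 hs)))

lemma hasCompactSupport_comp_displacement {F : Type*} [Zero F] {f : E → F}
    (hf : HasCompactSupport f) (hX : HasCompactSupport X) (s : ℝ) :
    HasCompactSupport (f ∘ displacement X s) := by
  refine HasCompactSupport.intro (hf.isCompact.union hX.isCompact) fun x hx => ?_
  rw [Set.mem_union, not_or] at hx
  simp [displacement, image_eq_zero_of_notMem_tsupport hx.1, image_eq_zero_of_notMem_tsupport hx.2]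

lemma tendstoUniformly_comp_displacement {F : Type*} [UniformSpace F] {f : E → F}
    (hf : Continuous f) (hX : Continuous X) (hc : HasCompactSupport X) :
    TendstoUniformly (fun s => f ∘ displacement X s) f (𝓝 0) := by
  intro u hu
  obtain ⟨v, hv, hvu⟩ := hc.isCompact.mem_uniformity_of_prod (q := (0 : ℝ)) (s := Set.univ)
    (f := fun s => f ∘ displacement X s)
    (hf.comp (continuous_displacement hX)).continuousOn (Set.mem_univ 0) (symm_le_uniformity hu)
  rw [nhdsWithin_univ] at hv
  filter_upwards [hv] with s hs x
  by_cases hx : x ∈ tsupport X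
  · simpa [displacement_zero] using hvu s hs x hx
  · simpa [displacement, image_eq_zero_of_notMem_tsupport hx] using refl_mem_uniformity hu

lemma eventually_norm_comp_displacement_sub_le {F : Type*} [NormedAddCommGroup F]
    [NormedSpace ℝ F] {f : E → F} (hf : ContDiff ℝ 1 f) (hX : Continuous X)
    (hc : HasCompactSupport X) {ε : ℝ} (hε : 0 < ε) :
    ∀ᶠ s in 𝓝 (0 : ℝ), ∀ x,
      ‖f (displacement X s x) - f x - fderiv ℝ f x (s • X x)‖ ≤ ε * |s| := by
  obtain ⟨A, hA⟩ := hc.exists_bound_of_continuous hX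
  have : 0 < |A| + 1 := by positivity
  have hunif := Metric.tendstoUniformly_iff.1 (tendstoUniformly_comp_displacement
    (hf.continuous_fderiv one_ne_zero) hX hc) (ε / (|A| + 1)) (by positivity)
  obtain ⟨δ, hδ, hball⟩ := Metric.eventually_nhds_iff_ball.1 hunif
  filter_upwards [Metric.ball_mem_nhds 0 hδ] with s hs x
  have hsegment : ∀ y ∈ segment ℝ x (displacement X s x),
      ‖fderiv ℝ f y - fderiv ℝ f x‖ ≤ ε / (|A| + 1) := by
    rw [segment_eq_image']
    rintro _ ⟨θ, ⟨hθ0, hθ1⟩, rfl⟩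
    have hθs : θ * s ∈ Metric.ball (0 : ℝ) δ := by
      rw [mem_ball_zero_iff, norm_mul, Real.norm_of_nonneg hθ0]
      exact (mul_le_of_le_one_left (norm_nonneg s) hθ1).trans_lt (mem_ball_zero_iff.1 hs)
    have h := (hball _ hθs x).le
    rw [dist_comm, dist_eq_norm] at h
    simpa [displacement, mul_smul] using h
  have hmean := (convex_segment x (displacement X s x)).norm_image_sub_le_of_norm_fderiv_le'
    (fun y _ => hf.differentiable one_ne_zero y) hsegment (left_mem_segment ..)
    (right_mem_segment ..)
  rw [show displacement X s x - x = s • X x by simp [displacement]] at hmean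
  have hXA : ‖X x‖ ≤ |A| + 1 := (hA x).trans ((le_abs_self A).trans (lt_add_one _).le)
  calc ‖f (displacement X s x) - f x - fderiv ℝ f x (s • X x)‖
      ≤ ε / (|A| + 1) * (|s| * ‖X x‖) := by rwa [norm_smul, Real.norm_eq_abs] at hmean
    _ ≤ ε / (|A| + 1) * (|s| * (|A| + 1)) := by gcongr
    _ = ε * |s| := by field_simp

end Displacement

section DualPotential

variable {E : Type*} [NormedAddCommGroup E] [InnerProductSpace ℝ E] [CompleteSpace E] {φ : E → ℝ}

/-- The potential of the velocity field `∇φ` after time `s`, read at the starting point `x` of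
the line `s ↦ x + s • ∇φ x`: the solution at time `s` of the Hamilton–Jacobi equation
`∂ₛu + ‖∇u‖² / 2 = 0` with `u = φ` at time `0` is `displacedPotential φ s x` at `x + s • ∇φ x`,
where its gradient is `∇φ x`. -/
def displacedPotential (φ : E → ℝ) (s : ℝ) (x : E) : ℝ := φ x + s / 2 * ‖gradient φ x‖ ^ 2

lemma displacedPotential_sub_sub_inner (s : ℝ) (x z : E) :
    displacedPotential φ s x - displacedPotential φ s z
        - ⟪gradient φ z, displacement (gradient φ) s x - displacement (gradient φ) s z⟫
      = φ x - φ z - ⟪gradient φ z, x - z⟫ + s / 2 * ‖gradient φ x - gradient φ z‖ ^ 2 := by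
  rw [displacement_apply_sub, norm_sub_sq_real, inner_add_right, inner_smul_right,
    inner_sub_right (gradient φ z) (gradient φ x), real_inner_self_eq_norm_sq,
    real_inner_comm (gradient φ x)]
  simp only [displacedPotential]
  ring

lemma abs_displacedPotential_sub_sub_inner_le {L : ℝ≥0} (hφ : Differentiable ℝ φ)
    (hL : LipschitzWith L (gradient φ)) {s : ℝ} (hs : |s| * L ≤ 1 / 8) (x z : E) :
    |displacedPotential φ s x - displacedPotential φ s z
        - ⟪gradient φ z, displacement (gradient φ) s x - displacement (gradient φ) s z⟫|
      ≤ 17 / 16 * L * ‖x - z‖ ^ 2 := by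
  have hquad : |s / 2 * ‖gradient φ x - gradient φ z‖ ^ 2| ≤ 1 / 16 * L * ‖x - z‖ ^ 2 :=
    calc |s / 2 * ‖gradient φ x - gradient φ z‖ ^ 2|
        = |s| / 2 * ‖gradient φ x - gradient φ z‖ ^ 2 := by
          rw [abs_mul, abs_div, abs_two, abs_sq]
      _ ≤ |s| / 2 * (L * ‖x - z‖) ^ 2 := by gcongr; exact hL.norm_sub_le x z
      _ = |s| * L * (L * ‖x - z‖ ^ 2 / 2) := by ring
      _ ≤ 1 / 8 * (L * ‖x - z‖ ^ 2 / 2) := by gcongr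
      _ = 1 / 16 * L * ‖x - z‖ ^ 2 := by ring
  rw [displacedPotential_sub_sub_inner]
  linarith [abs_add_le (φ x - φ z - ⟪gradient φ z, x - z⟫)
    (s / 2 * ‖gradient φ x - gradient φ z‖ ^ 2), abs_sub_sub_inner_gradient_le hφ hL x z]

lemma norm_sq_displacement_sub_le {L : ℝ≥0} (hφ : Differentiable ℝ φ)
    (hL : LipschitzWith L (gradient φ)) {s t : ℝ} (hs : |s| * L ≤ 1 / 8) (ht : |t| * L ≤ 1 / 8)
    (x z : E) :
    ‖displacement (gradient φ) s z - displacement (gradient φ) t z‖ ^ 2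
      ≤ ‖displacement (gradient φ) s x - displacement (gradient φ) t z‖ ^ 2
        + (2 * (t - s) * displacedPotential φ s x - 2 * (t - s) * displacedPotential φ s z) := by
  set Δ := displacement (gradient φ) s x - displacement (gradient φ) s z with hΔ
  set e := displacedPotential φ s x - displacedPotential φ s z - ⟪gradient φ z, Δ⟫
  have hsplit : displacement (gradient φ) s x - displacement (gradient φ) t z
      = Δ - (t - s) • gradient φ z := by
    rw [hΔ, ← displacement_sub_displacement s t z, sub_sub_sub_cancel_right]
  have herror : |e| ≤ 17 / 16 * L * ‖x - z‖ ^ 2 :=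
    abs_displacedPotential_sub_sub_inner_le hφ hL hs x z
  have hexpand : 7 / 8 * ‖x - z‖ ≤ ‖Δ‖ := by
    refine le_trans ?_ (mul_norm_sub_le_norm_displacement_sub hL s x z)
    gcongr
    linarith
  have hstep : |t - s| * L ≤ 1 / 4 := by
    have := mul_le_mul_of_nonneg_right (abs_sub t s) L.coe_nonneg
    linarith
  have habsorb : |2 * (t - s) * e| ≤ ‖Δ‖ ^ 2 :=
    calc |2 * (t - s) * e| = 2 * |t - s| * |e| := by rw [abs_mul, abs_mul, abs_two]
      _ ≤ 2 * |t - s| * (17 / 16 * L * ‖x - z‖ ^ 2) := by gcongr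
      _ = |t - s| * L * (17 / 8 * ‖x - z‖ ^ 2) := by ring
      _ ≤ 1 / 4 * (17 / 8 * ‖x - z‖ ^ 2) := by gcongr
      _ ≤ (7 / 8 * ‖x - z‖) ^ 2 := by nlinarith [sq_nonneg ‖x - z‖]
      _ ≤ ‖Δ‖ ^ 2 := by gcongr
  rw [hsplit, norm_sub_rev, displacement_sub_displacement, norm_sub_sq_real, inner_smul_right,
    real_inner_comm]
  linarith [neg_le_of_abs_le habsorb]

end DualPotential

section Lift

variable {α β α' β' : Type*} [MeasurableSpace α] [MeasurableSpace β] [MeasurableSpace α']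
  [MeasurableSpace β'] {μ : Measure α} {ν : Measure β} {S : α → α'} {T : β → β'}

lemma map_fst_map_prodMap (π : Measure (α × β)) (hS : Measurable S) (hT : Measurable T) :
    (π.map (Prod.map S T)).map Prod.fst = (π.map Prod.fst).map S := by
  rw [Measure.map_map measurable_fst (hS.prodMap hT), Measure.map_map hS measurable_fst]
  rfl

lemma map_snd_map_prodMap (π : Measure (α × β)) (hS : Measurable S) (hT : Measurable T) :
    (π.map (Prod.map S T)).map Prod.snd = (π.map Prod.snd).map T := by
  rw [Measure.map_map measurable_snd (hS.prodMap hT), Measure.map_map hT measurable_snd]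
  rfl

lemma exists_map_prodMap_eq (hS : MeasurableEmbedding S) (hT : MeasurableEmbedding T)
    {γ : Measure (α' × β')} (h₁ : γ.map Prod.fst = μ.map S) (h₂ : γ.map Prod.snd = ν.map T) :
    ∃ π : Measure (α × β),
      π.map Prod.fst = μ ∧ π.map Prod.snd = ν ∧ π.map (Prod.map S T) = γ := by
  have hST : MeasurableEmbedding (Prod.map S T) := hS.prodMap hT
  have hrange : ∀ᵐ p ∂γ, p ∈ Set.range (Prod.map S T) := by
    have hfst : ∀ᵐ a ∂γ.map Prod.fst, a ∈ Set.range S := by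
      rw [h₁, hS.ae_map_iff]
      exact ae_of_all _ Set.mem_range_self
    have hsnd : ∀ᵐ b ∂γ.map Prod.snd, b ∈ Set.range T := by
      rw [h₂, hT.ae_map_iff]
      exact ae_of_all _ Set.mem_range_self
    filter_upwards [ae_of_ae_map measurable_fst.aemeasurable hfst,
      ae_of_ae_map measurable_snd.aemeasurable hsnd] with p hp₁ hp₂
    rw [Set.range_prodMap]
    exact ⟨hp₁, hp₂⟩
  have hlift : (γ.comap (Prod.map S T)).map (Prod.map S T) = γ := by
    rw [hST.map_comap, Measure.restrict_eq_self_of_ae_mem hrange]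
  refine ⟨γ.comap (Prod.map S T), ?_, ?_, hlift⟩
  · rw [← hS.comap_map ((γ.comap (Prod.map S T)).map Prod.fst),
      ← map_fst_map_prodMap _ hS.measurable hT.measurable, hlift, h₁, hS.comap_map]
  · rw [← hT.comap_map ((γ.comap (Prod.map S T)).map Prod.snd),
      ← map_snd_map_prodMap _ hS.measurable hT.measurable, hlift, h₂, hT.comap_map]

end Lift

section SquareIntegrable

variable {α : Type*} [MeasurableSpace α] {μ : Measure α}

lemma lintegral_enorm_sq_eq_eLpNorm_sq {E : Type*} [NormedAddCommGroup E] (f : α → E)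
    (μ : Measure α) : ∫⁻ x, ‖f x‖ₑ ^ 2 ∂μ = eLpNorm f 2 μ ^ 2 := by
  simpa using (eLpNorm_nnreal_pow_eq_lintegral (μ := μ) (f := f) (p := 2) (by simp)).symm

lemma lintegral_enorm_sq_eq_ofReal_integral {E : Type*} [NormedAddCommGroup E] {f : α → E}
    (hf : MemLp f 2 μ) : ∫⁻ x, ‖f x‖ₑ ^ 2 ∂μ = ENNReal.ofReal (∫ x, ‖f x‖ ^ 2 ∂μ) := by
  rw [ofReal_integral_eq_lintegral_ofReal (hf.integrable_norm_pow (p := 2) (by simp))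
    (ae_of_all _ fun x => by positivity)]
  simp_rw [ENNReal.ofReal_pow (norm_nonneg _), ofReal_norm]

lemma enorm_integral_bilin_le {E F G : Type*} [NormedAddCommGroup E] [NormedAddCommGroup F]
    [NormedAddCommGroup G] [NormedSpace ℝ G] {b : E → F → G} (hb : ∀ u v, ‖b u v‖ ≤ ‖u‖ * ‖v‖)
    {f : α → E} {g : α → F} (hf : AEStronglyMeasurable f μ) (hg : AEStronglyMeasurable g μ) :
    ‖∫ x, b (f x) (g x) ∂μ‖ₑ ≤ eLpNorm f 2 μ * eLpNorm g 2 μ := by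
  refine (enorm_integral_le_lintegral_enorm _).trans ?_
  rw [← eLpNorm_one_eq_lintegral_enorm]
  simpa using eLpNorm_le_eLpNorm_mul_eLpNorm_of_nnnorm (p := 2) (q := 2) (r := 1) hf hg b 1
    (ae_of_all _ fun x => by rw [one_mul]; exact hb (f x) (g x))

lemma integrable_inner_of_memLp {E : Type*} [NormedAddCommGroup E] [InnerProductSpace ℝ E]
    {f g : α → E} (hf : MemLp f 2 μ) (hg : MemLp g 2 μ) : Integrable (fun x => ⟪f x, g x⟫) μ :=
  memLp_one_iff_integrable.1 (hf.of_bilin (fun u v => ⟪u, v⟫) 1 hg (hf.1.inner hg.1)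
    (ae_of_all _ fun x => by rw [one_mul]; exact nnnorm_inner_le_nnnorm (f x) (g x)))

end SquareIntegrable

section Transport

variable {d : ℕ} {μ : P2 d}

lemma P2.memLp_id (μ : P2 d) : MemLp id 2 μ.meas :=
  ⟨aestronglyMeasurable_id, by
    have h := (lintegral_enorm_sq_eq_eLpNorm_sq id μ.meas).symm.trans_lt μ.2.2
    rwa [ENNReal.pow_lt_top_iff, or_iff_left two_ne_zero] at h⟩

/-- The image of `μ` under a square integrable map. -/
def P2.map (μ : P2 d) {T : Eu d → Eu d} (hT : MemLp T 2 μ.meas) : P2 d :=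
  ⟨μ.meas.map T, Measure.isProbabilityMeasure_map hT.1.aemeasurable, by
    have hid : MemLp id 2 (μ.meas.map T) :=
      (memLp_map_measure_iff aestronglyMeasurable_id hT.1.aemeasurable).2 hT
    exact (lintegral_enorm_sq_eq_eLpNorm_sq id _).trans_lt (ENNReal.pow_lt_top hid.2)⟩

lemma map_prodMk_mem_couplings {S T : Eu d → Eu d} (hS : MemLp S 2 μ.meas)
    (hT : MemLp T 2 μ.meas) :
    μ.meas.map (fun x => (S x, T x)) ∈ couplings (μ.map hS) (μ.map hT) := by
  constructor
  · rw [AEMeasurable.map_map_of_aemeasurable (by fun_prop)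
      (hS.1.aemeasurable.prodMk hT.1.aemeasurable)]
    rfl
  · rw [AEMeasurable.map_map_of_aemeasurable (by fun_prop)
      (hS.1.aemeasurable.prodMk hT.1.aemeasurable)]
    rfl

lemma cost_map_prodMk {α : Type*} [MeasurableSpace α] {π : Measure α} {S T : α → Eu d}
    (hS : MemLp S 2 π) (hT : MemLp T 2 π) :
    cost (π.map fun x => (S x, T x)) = ENNReal.ofReal (∫ x, ‖S x - T x‖ ^ 2 ∂π) := by
  rw [cost, lintegral_map' (by fun_prop) (hS.1.aemeasurable.prodMk hT.1.aemeasurable)]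
  exact lintegral_enorm_sq_eq_ofReal_integral (hS.sub hT)

/-- Kantorovich duality: `u` is a potential pulled back along `S`, and its increments `u x - u z`
integrate to zero against every plan. -/
lemma map_prodMk_mem_optimalPlans {S T : Eu d → Eu d} (hS : MemLp S 2 μ.meas)
    (hT : MemLp T 2 μ.meas) (hSe : MeasurableEmbedding S) (hTe : MeasurableEmbedding T)
    {u : Eu d → ℝ} (hu : Integrable u μ.meas)
    (hle : ∀ x z, ‖S z - T z‖ ^ 2 ≤ ‖S x - T z‖ ^ 2 + (u x - u z)) :
    μ.meas.map (fun x => (S x, T x)) ∈ optimalPlans (μ.map hS) (μ.map hT) := by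
  refine ⟨map_prodMk_mem_couplings hS hT, fun γ hγ => ?_⟩
  obtain ⟨π, hfst, hsnd, rfl⟩ := exists_map_prodMap_eq hSe hTe hγ.1 hγ.2
  have hπ₁ : MeasurePreserving Prod.fst π μ.meas := ⟨measurable_fst, hfst⟩
  have hπ₂ : MeasurePreserving Prod.snd π μ.meas := ⟨measurable_snd, hsnd⟩
  have hS₁ : MemLp (fun p : Eu d × Eu d => S p.1) 2 π := hS.comp_measurePreserving hπ₁
  have hT₂ : MemLp (fun p : Eu d × Eu d => T p.2) 2 π := hT.comp_measurePreserving hπ₂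
  have hu₁ : Integrable (fun p : Eu d × Eu d => u p.1) π := hπ₁.integrable_comp_of_integrable hu
  have hu₂ : Integrable (fun p : Eu d × Eu d => u p.2) π := hπ₂.integrable_comp_of_integrable hu
  have hST : Integrable (fun x => ‖S x - T x‖ ^ 2) μ.meas :=
    (hS.sub hT).integrable_norm_pow (p := 2) (by simp)
  have hcost : Integrable (fun p : Eu d × Eu d => ‖S p.1 - T p.2‖ ^ 2) π :=
    (hS₁.sub hT₂).integrable_norm_pow (p := 2) (by simp)
  have hgain : Integrable (fun p : Eu d × Eu d => u p.1 - u p.2) π := hu₁.sub hu₂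
  rw [cost_map_prodMk hS hT,
    show Prod.map S T = fun p : Eu d × Eu d => (S p.1, T p.2) from rfl, cost_map_prodMk hS₁ hT₂]
  refine ENNReal.ofReal_le_ofReal ?_
  calc ∫ x, ‖S x - T x‖ ^ 2 ∂μ.meas = ∫ p, ‖S p.2 - T p.2‖ ^ 2 ∂π := by
        rw [← hsnd, integral_map (by fun_prop) (hsnd ▸ hST.1)]
    _ ≤ ∫ p, (‖S p.1 - T p.2‖ ^ 2 + (u p.1 - u p.2)) ∂π :=
        integral_mono (hπ₂.integrable_comp_of_integrable hST) (hcost.add hgain)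
          fun p => hle p.1 p.2
    _ = ∫ p, ‖S p.1 - T p.2‖ ^ 2 ∂π + (∫ x, u x ∂μ.meas - ∫ x, u x ∂μ.meas) := by
        rw [integral_add hcost hgain, integral_sub hu₁ hu₂]
        nth_rewrite 1 [← hfst]
        rw [← hsnd, integral_map (by fun_prop) (hfst ▸ hu.1),
          integral_map (by fun_prop) (hsnd ▸ hu.1)]
    _ = ∫ p, ‖S p.1 - T p.2‖ ^ 2 ∂π := by rw [sub_self, add_zero]

lemma W2_eq_sqrt_cost {ν : P2 d} {γ : Measure (Eu d × Eu d)} (hγ : γ ∈ optimalPlans μ ν) :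
    W2 μ ν = √(cost γ).toReal := by
  rw [W2, le_antisymm (iInf₂_le γ hγ.1) (le_iInf₂ hγ.2)]

lemma P2.memLp_displacement {X : Eu d → Eu d} (hX : MemLp X 2 μ.meas) (s : ℝ) :
    MemLp (displacement X s) 2 μ.meas :=
  μ.memLp_id.add (hX.const_smul s)

/-- The curve of measures issued from `μ` in the direction of the vector field `X`. -/
def P2.displace (μ : P2 d) {X : Eu d → Eu d} (hX : MemLp X 2 μ.meas) (s : ℝ) : P2 d :=
  μ.map (P2.memLp_displacement hX s)

lemma P2.displace_zero {X : Eu d → Eu d} (hX : MemLp X 2 μ.meas) : μ.displace hX 0 = μ :=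
  Subtype.ext <| by
    change μ.meas.map (displacement X 0) = μ.meas
    rw [displacement_zero, Measure.map_id]

lemma map_displacement_mem_optimalPlans {φ : Eu d → ℝ} {L : ℝ≥0} (hφ : Differentiable ℝ φ)
    (hL : LipschitzWith L (gradient φ)) (hφ₁ : Integrable φ μ.meas)
    (hφ₂ : MemLp (gradient φ) 2 μ.meas) {s t : ℝ} (hs : |s| * L ≤ 1 / 8) (ht : |t| * L ≤ 1 / 8) :
    μ.meas.map (fun x => (displacement (gradient φ) s x, displacement (gradient φ) t x))
      ∈ optimalPlans (μ.displace hφ₂ s) (μ.displace hφ₂ t) :=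
  map_prodMk_mem_optimalPlans _ _ (measurableEmbedding_displacement hL (by linarith))
    (measurableEmbedding_displacement hL (by linarith))
    ((hφ₁.add ((hφ₂.integrable_norm_pow (p := 2) (by simp)).const_mul (s / 2))).const_mul
      (2 * (t - s)))
    (norm_sq_displacement_sub_le hφ hL hs ht)

lemma W2_displace {φ : Eu d → ℝ} {L : ℝ≥0} (hφ : Differentiable ℝ φ)
    (hL : LipschitzWith L (gradient φ)) (hφ₁ : Integrable φ μ.meas)
    (hφ₂ : MemLp (gradient φ) 2 μ.meas) {s t : ℝ} (hs : |s| * L ≤ 1 / 8) (ht : |t| * L ≤ 1 / 8) :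
    W2 (μ.displace hφ₂ s) (μ.displace hφ₂ t) = |t - s| * √(∫ x, ‖gradient φ x‖ ^ 2 ∂μ.meas) := by
  rw [W2_eq_sqrt_cost (map_displacement_mem_optimalPlans hφ hL hφ₁ hφ₂ hs ht),
    cost_map_prodMk (P2.memLp_displacement hφ₂ s) (P2.memLp_displacement hφ₂ t),
    ENNReal.toReal_ofReal (integral_nonneg fun x => by positivity), ← Real.sqrt_sq_eq_abs,
    ← Real.sqrt_mul (sq_nonneg _), ← integral_const_mul]
  simp_rw [norm_sub_rev (displacement _ s _), displacement_sub_displacement, norm_smul, mul_pow,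
    Real.norm_eq_abs, sq_abs]

end Transport

section TestFunction

/-- The test functions `C_c^∞`, whose gradients span the tangent spaces. -/
structure IsTestFunction {E : Type*} [NormedAddCommGroup E] [NormedSpace ℝ E] (φ : E → ℝ) :
    Prop where
  contDiff : ContDiff ℝ ∞ φ
  hasCompactSupport : HasCompactSupport φ

namespace IsTestFunction

section NormedSpace

variable {E : Type*} [NormedAddCommGroup E] [NormedSpace ℝ E] {φ ψ : E → ℝ}

lemma differentiable (hφ : IsTestFunction φ) : Differentiable ℝ φ :=
  hφ.contDiff.differentiable (by simp)

lemma zero : IsTestFunction (0 : E → ℝ) := ⟨contDiff_const, HasCompactSupport.zero⟩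

lemma add (hφ : IsTestFunction φ) (hψ : IsTestFunction ψ) : IsTestFunction (φ + ψ) :=
  ⟨hφ.contDiff.add hψ.contDiff, hφ.hasCompactSupport.add hψ.hasCompactSupport⟩

lemma const_smul (hφ : IsTestFunction φ) (a : ℝ) : IsTestFunction (a • φ) :=
  ⟨hφ.contDiff.const_smul a, hφ.hasCompactSupport.smul_left (f := fun _ => a)⟩

lemma comp_displacement {X : E → E} (hφ : IsTestFunction φ) (hX : ContDiff ℝ ∞ X)
    (hc : HasCompactSupport X) (s : ℝ) : IsTestFunction (φ ∘ displacement X s) :=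
  ⟨hφ.contDiff.comp (contDiff_displacement hX s),
    hasCompactSupport_comp_displacement hφ.hasCompactSupport hc s⟩

lemma integrable [MeasurableSpace E] [OpensMeasurableSpace E] (hφ : IsTestFunction φ)
    {μ : Measure E} [IsFiniteMeasureOnCompacts μ] : Integrable φ μ :=
  hφ.contDiff.continuous.integrable_of_hasCompactSupport hφ.hasCompactSupport

end NormedSpace

variable {E : Type*} [NormedAddCommGroup E] [InnerProductSpace ℝ E] [CompleteSpace E] {φ : E → ℝ}

lemma contDiff_gradient (hφ : IsTestFunction φ) : ContDiff ℝ ∞ (gradient φ) :=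
  WassersteinOpt.contDiff_gradient hφ.contDiff (by simp)

lemma hasCompactSupport_gradient (hφ : IsTestFunction φ) : HasCompactSupport (gradient φ) :=
  WassersteinOpt.hasCompactSupport_gradient hφ.hasCompactSupport

lemma memLp_gradient [MeasurableSpace E] [OpensMeasurableSpace E] (hφ : IsTestFunction φ)
    {p : ℝ≥0∞} {μ : Measure E} [IsFiniteMeasureOnCompacts μ] : MemLp (gradient φ) p μ :=
  hφ.contDiff_gradient.continuous.memLp_of_hasCompactSupport hφ.hasCompactSupport_gradient

lemma exists_lipschitzWith_gradient (hφ : IsTestFunction φ) :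
    ∃ L : ℝ≥0, LipschitzWith L (gradient φ) :=
  hφ.contDiff_gradient.lipschitzWith_of_hasCompactSupport hφ.hasCompactSupport_gradient (by simp)

end IsTestFunction

end TestFunction

section Tangent

variable {d : ℕ} {ν : P2 d} {ξ : Eu d → Eu d}

lemma InTangent.integral_inner_comp_eq_zero (hξ : InTangent ν ξ) {α : Type*} [MeasurableSpace α]
    {π : Measure α} {S : α → Eu d} (hS : MeasurePreserving S π ν.meas) {m : α → Eu d}
    (hm : MemLp m 2 π)
    (h : ∀ ψ, IsTestFunction ψ → ∫ x, ⟪gradient ψ (S x), m x⟫ ∂π = 0) :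
    ∫ x, ⟪ξ (S x), m x⟫ ∂π = 0 := by
  have hle : ∀ ε > 0, ‖∫ x, ⟪ξ (S x), m x⟫ ∂π‖ₑ ≤ ε * eLpNorm m 2 π := fun ε hε => by
    obtain ⟨ψ, hψ, hψc, hlt⟩ := hξ.2 ε hε
    have hψ' : IsTestFunction ψ := ⟨hψ, hψc⟩
    have hdiff : MemLp (fun x => ξ x - gradient ψ x) 2 ν.meas := hξ.1.sub hψ'.memLp_gradient
    calc ‖∫ x, ⟪ξ (S x), m x⟫ ∂π‖ₑ = ‖∫ x, ⟪ξ (S x) - gradient ψ (S x), m x⟫ ∂π‖ₑ := by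
          have hξS := hξ.1.comp_measurePreserving hS
          have hψS := (hψ'.memLp_gradient (p := 2)).comp_measurePreserving hS
          have hsub := integral_sub (integrable_inner_of_memLp hξS hm)
            (integrable_inner_of_memLp hψS hm)
          simp only [Function.comp_apply, h ψ hψ', sub_zero, ← inner_sub_left] at hsub
          rw [hsub]
      _ ≤ eLpNorm ((fun x => ξ x - gradient ψ x) ∘ S) 2 π * eLpNorm m 2 π :=
          enorm_integral_bilin_le (b := fun u v => ⟪u, v⟫) norm_inner_le_norm
            (hdiff.comp_measurePreserving hS).1 hm.1
      _ ≤ ε * eLpNorm m 2 π := by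
          rw [eLpNorm_comp_measurePreserving hdiff.1 hS]
          gcongr
  have hlim : Tendsto (fun ε => ε * eLpNorm m 2 π) (𝓝[>] 0) (𝓝 0) := by
    simpa using (ENNReal.Tendsto.mul_const tendsto_id (Or.inr hm.2.ne)).mono_left
      (nhdsWithin_le_nhds (a := (0 : ℝ≥0∞)) (s := Set.Ioi 0))
  exact enorm_eq_zero.1 (le_zero_iff.1
    (ge_of_tendsto hlim (eventually_nhdsWithin_of_forall hle)))

lemma IsWGradient.inTangent {Φ : P2 d → ℝ} (h : IsWGradient Φ ν ξ) : InTangent ν ξ := by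
  obtain ⟨_, _, _, hξ⟩ := h
  exact hξ.1

end Tangent

section FirstOrder

variable {d : ℕ} {μ : P2 d} {φ : Eu d → ℝ} {Φ : P2 d → ℝ} {ξ : Eu d → Eu d}

lemma measurePreserving_displacement {X : Eu d → Eu d} (hX : MemLp X 2 μ.meas)
    (hXm : Measurable X) (s : ℝ) :
    MeasurePreserving (displacement X s) μ.meas (μ.displace hX s).meas :=
  ⟨measurable_id.add (hXm.const_smul s), rfl⟩

lemma IsWGradientWith.abs_displace_sub_le {L : ℝ≥0} {C r s t : ℝ} (hφ : IsTestFunction φ)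
    (hL : LipschitzWith L (gradient φ)) (hs : |s| * L ≤ 1 / 8) (ht : |t| * L ≤ 1 / 8)
    (h : IsWGradientWith Φ (μ.displace hφ.memLp_gradient s) ξ C r)
    (hr : |t - s| * √(∫ x, ‖gradient φ x‖ ^ 2 ∂μ.meas) < r) :
    |Φ (μ.displace hφ.memLp_gradient t) - Φ (μ.displace hφ.memLp_gradient s)
        - (t - s) * ∫ x, ⟪ξ (displacement (gradient φ) s x), gradient φ x⟫ ∂μ.meas|
      ≤ C * (∫ x, ‖gradient φ x‖ ^ 2 ∂μ.meas) * (t - s) ^ 2 := by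
  have hplan := map_displacement_mem_optimalPlans (μ := μ) hφ.differentiable hL hφ.integrable
    hφ.memLp_gradient hs ht
  have hW := W2_displace (μ := μ) hφ.differentiable hL hφ.integrable hφ.memLp_gradient hs ht
  have hξ := h.1.1.1.comp_measurePreserving ⟨measurable_fst, hplan.1.1⟩
  have hmeas : Measurable fun x =>
      (displacement (gradient φ) s x, displacement (gradient φ) t x) :=
    (contDiff_displacement hφ.contDiff_gradient s).continuous.measurable.prodMk
      (contDiff_displacement hφ.contDiff_gradient t).continuous.measurable
  have hexp := h.2 _ (hW ▸ hr) _ hplan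
  rw [integral_map hmeas.aemeasurable
    (hξ.inner (measurable_snd.sub measurable_fst).aestronglyMeasurable), hW, mul_pow, sq_abs,
    Real.sq_sqrt (integral_nonneg fun x => by positivity)] at hexp
  simp_rw [displacement_sub_displacement, inner_smul_right] at hexp
  rw [integral_const_mul] at hexp
  linarith

lemma eventually_abs_mul_le {s L : ℝ} (hs : |s| * L < 1 / 8) :
    ∀ᶠ t in 𝓝 s, |t| * L ≤ 1 / 8 :=
  (continuous_abs.mul continuous_const).continuousAt.eventually_le_const hs

lemma eventually_abs_sub_mul_lt (s a : ℝ) {r : ℝ} (hr : 0 < r) :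
    ∀ᶠ t in 𝓝 s, |t - s| * a < r :=
  (((continuous_id.sub continuous_const).abs.mul continuous_const).continuousAt).eventually_lt_const
    (by simpa using hr)

lemma IsWGradient.hasDerivAt_displace {L : ℝ≥0} {s : ℝ} (hφ : IsTestFunction φ)
    (hL : LipschitzWith L (gradient φ)) (hs : |s| * L < 1 / 8)
    (h : IsWGradient Φ (μ.displace hφ.memLp_gradient s) ξ) :
    HasDerivAt (fun t => Φ (μ.displace hφ.memLp_gradient t))
      (∫ x, ⟪ξ (displacement (gradient φ) s x), gradient φ x⟫ ∂μ.meas) s := by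
  obtain ⟨C, r, hr, h⟩ := h
  rw [hasDerivAt_iff_isLittleO]
  refine (Asymptotics.IsBigO.of_bound (C * ∫ x, ‖gradient φ x‖ ^ 2 ∂μ.meas) ?_).trans_isLittleO
    (Asymptotics.isLittleO_pow_sub_sub s one_lt_two)
  filter_upwards [eventually_abs_mul_le hs, eventually_abs_sub_mul_lt s _ hr] with t ht htr
  rw [smul_eq_mul, norm_pow, norm_norm, Real.norm_eq_abs, Real.norm_eq_abs, sq_abs]
  exact h.abs_displace_sub_le hφ hL hs.le ht htr

lemma IsW2LocalMin.isLocalMin_displace (hmin : IsW2LocalMin Φ μ) (hφ : IsTestFunction φ) :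
    IsLocalMin (fun t => Φ (μ.displace hφ.memLp_gradient t)) 0 := by
  obtain ⟨r, hr, hmin⟩ := hmin
  obtain ⟨L, hL⟩ := hφ.exists_lipschitzWith_gradient
  filter_upwards [eventually_abs_mul_le (s := 0) (L := L) (by simp),
    eventually_abs_sub_mul_lt 0 (√(∫ x, ‖gradient φ x‖ ^ 2 ∂μ.meas)) hr] with t ht htr
  have hW := W2_displace (μ := μ) hφ.differentiable hL hφ.integrable hφ.memLp_gradient ht
    (t := 0) (by simp)
  rw [abs_sub_comm, ← hW, P2.displace_zero] at htr
  rw [P2.displace_zero]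
  exact hmin _ htr

lemma IsW2LocalMin.ae_eq_zero (hmin : IsW2LocalMin Φ μ) (h : IsWGradient Φ μ ξ) :
    ∀ᵐ x ∂μ.meas, ξ x = 0 := by
  obtain ⟨_, _, _, htan, _⟩ := id h
  have horth : ∀ φ, IsTestFunction φ → ∫ x, ⟪gradient φ x, ξ x⟫ ∂μ.meas = 0 := fun φ hφ => by
    obtain ⟨L, hL⟩ := hφ.exists_lipschitzWith_gradient
    have h₀ : IsWGradient Φ (μ.displace hφ.memLp_gradient 0) ξ := by rwa [P2.displace_zero]
    have hderiv := h₀.hasDerivAt_displace hφ hL (by simp)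
    simpa only [displacement_zero, id, real_inner_comm] using
      (hmin.isLocalMin_displace hφ).hasDerivAt_eq_zero hderiv
  have hnorm : ∫ x, ⟪ξ x, ξ x⟫ ∂μ.meas = 0 :=
    htan.integral_inner_comp_eq_zero (.id _) htan.1 horth
  rw [integral_eq_zero_iff_of_nonneg (fun x => real_inner_self_nonneg)
    (integrable_inner_of_memLp htan.1 htan.1)] at hnorm
  filter_upwards [hnorm] with x hx
  exact inner_self_eq_zero.1 hx

lemma ae_fderiv_eq_zero {E : Type*} [NormedAddCommGroup E] [NormedSpace ℝ E]
    [FiniteDimensional ℝ E] [MeasurableSpace E] [BorelSpace E] {μ ρ : Measure E}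
    [ρ.IsAddHaarMeasure] (hac : μ ≪ ρ) {f : E → E} (hf : Differentiable ℝ f)
    (h0 : ∀ᵐ x ∂μ, f x = 0) : ∀ᵐ x ∂μ, fderiv ℝ f x = 0 := by
  have hs : MeasurableSet (f ⁻¹' {0}) :=
    (isClosed_singleton.preimage hf.continuous).measurableSet
  have happrox : ApproximatesLinearOn f (0 : E →L[ℝ] E) (f ⁻¹' {0}) 0 := fun x hx y hy => by
    rw [Set.mem_preimage, Set.mem_singleton_iff] at hx hy
    simp [hx, hy]
  have hzero := happrox.norm_fderiv_sub_le ρ hs (fderiv ℝ f)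
    fun x _ => (hf x).hasFDerivAt.hasFDerivWithinAt
  rw [ae_restrict_iff' hs] at hzero
  filter_upwards [hac.ae_le hzero, h0] with x hx hx0
  simpa using hx hx0

end FirstOrder

section KernelOperator

variable {α β E F : Type*} [MeasurableSpace α] [MeasurableSpace β] {μ : Measure α}
  {ν : Measure β} [NormedAddCommGroup E] [NormedSpace ℝ E] [NormedAddCommGroup F]
  [NormedSpace ℝ F] {κ : α × β → E →L[ℝ] F} {f : β → E}

lemma integrable_clm_apply_of_memLp {A : β → E →L[ℝ] F} (hA : MemLp A 2 ν)
    (hf : MemLp f 2 ν) : Integrable (fun y => A y (f y)) ν :=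
  memLp_one_iff_integrable.1 (hA.of_bilin (fun (T : E →L[ℝ] F) v => T v) 1 hf
    ((ContinuousLinearMap.apply ℝ F).aestronglyMeasurable_comp₂ hf.1 hA.1)
    (ae_of_all _ fun y => by rw [one_mul]; exact (A y).le_opNNNorm (f y)))

variable [SFinite ν]

lemma ae_memLp_two_prodMk_left [SFinite μ] (hκ : MemLp κ 2 (μ.prod ν)) :
    ∀ᵐ x ∂μ, MemLp (fun y => κ (x, y)) 2 ν := by
  filter_upwards [hκ.1.prodMk_left,
    (hκ.integrable_norm_pow (p := 2) (by simp)).prod_right_ae] with x hmeas hint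
  exact (memLp_two_iff_integrable_sq_norm hmeas).2 hint

lemma eLpNorm_integral_kernel_le [SFinite μ] (hκ : MemLp κ 2 (μ.prod ν)) (hf : MemLp f 2 ν) :
    eLpNorm (fun x => ∫ y, κ (x, y) (f y) ∂ν) 2 μ ≤ eLpNorm κ 2 (μ.prod ν) * eLpNorm f 2 ν := by
  rw [← ENNReal.pow_le_pow_left_iff two_ne_zero, mul_pow, ← lintegral_enorm_sq_eq_eLpNorm_sq,
    ← lintegral_enorm_sq_eq_eLpNorm_sq κ, lintegral_prod _ (hκ.1.enorm.pow_const 2),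
    ← lintegral_mul_const' _ _ (ENNReal.pow_ne_top hf.2.ne)]
  refine lintegral_mono_ae ?_
  filter_upwards [ae_memLp_two_prodMk_left hκ] with x hx
  rw [lintegral_enorm_sq_eq_eLpNorm_sq (fun y => κ (x, y)), ← mul_pow]
  gcongr
  exact enorm_integral_bilin_le (b := fun (T : E →L[ℝ] F) v => T v)
    (fun T v => T.le_opNorm v) hx.1 hf.1

lemma memLp_integral_kernel [SFinite μ] (hκ : MemLp κ 2 (μ.prod ν)) (hf : MemLp f 2 ν) :
    MemLp (fun x => ∫ y, κ (x, y) (f y) ∂ν) 2 μ := by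
  have hmeas : AEStronglyMeasurable (fun p : α × β => κ p (f p.2)) (μ.prod ν) :=
    (ContinuousLinearMap.apply ℝ F).aestronglyMeasurable_comp₂ hf.1.comp_snd hκ.1
  exact ⟨hmeas.integral_prod_right', (eLpNorm_integral_kernel_le hκ hf).trans_lt
    (ENNReal.mul_lt_top hκ.2 hf.2)⟩

lemma exists_integralOperator [SFinite μ] (hκ : MemLp κ 2 (μ.prod ν)) :
    ∃ T : Lp E 2 ν →L[ℝ] Lp F 2 μ, ∀ f, T f =ᵐ[μ] fun x => ∫ y, κ (x, y) (f y) ∂ν := by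
  have hmem (f : Lp E 2 ν) := memLp_integral_kernel hκ (Lp.memLp f)
  let T : Lp E 2 ν →ₗ[ℝ] Lp F 2 μ :=
    { toFun := fun f => (hmem f).toLp _
      map_add' := fun f g => by
        rw [← MemLp.toLp_add]
        refine MemLp.toLp_congr _ _ ?_
        filter_upwards [ae_memLp_two_prodMk_left hκ] with x hx
        rw [Pi.add_apply, ← integral_add (integrable_clm_apply_of_memLp hx (Lp.memLp f))
          (integrable_clm_apply_of_memLp hx (Lp.memLp g))]
        refine integral_congr_ae ?_
        filter_upwards [Lp.coeFn_add f g] with y hy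
        rw [hy, Pi.add_apply, map_add]
      map_smul' := fun a f => by
        rw [RingHom.id_apply, ← MemLp.toLp_const_smul]
        refine MemLp.toLp_congr _ _ (ae_of_all _ fun x => ?_)
        rw [Pi.smul_apply, ← integral_smul]
        refine integral_congr_ae ?_
        filter_upwards [Lp.coeFn_smul a f] with y hy
        rw [hy, Pi.smul_apply, map_smul] }
  refine ⟨T.mkContinuous (eLpNorm κ 2 (μ.prod ν)).toReal fun f => ?_,
    fun f => (hmem f).coeFn_toLp⟩
  change ‖(hmem f).toLp _‖ ≤ _
  rw [Lp.norm_toLp, Lp.norm_def, ← ENNReal.toReal_mul]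
  exact ENNReal.toReal_mono (ENNReal.mul_lt_top hκ.2 (Lp.memLp f).2).ne
    (eLpNorm_integral_kernel_le hκ (Lp.memLp f))

end KernelOperator

section MatrixKernel

variable {α ι : Type*} [MeasurableSpace α] {μ : Measure α} [Fintype ι] [DecidableEq ι]

lemma memLp_toEuclideanCLM {p : ℝ≥0∞} {k : α → Matrix ι ι ℝ}
    (hk : ∀ i j, MemLp (fun x => k x i j) p μ) :
    MemLp (fun x => Matrix.toEuclideanCLM (𝕜 := ℝ) (k x)) p μ := by
  have hpi : MemLp (fun x i j => k x i j) p μ :=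
    MemLp.of_eval fun i => MemLp.of_eval (hk i)
  let L : (ι → ι → ℝ) →ₗ[ℝ] EuclideanSpace ℝ ι →L[ℝ] EuclideanSpace ℝ ι :=
    (Matrix.toEuclideanCLM (n := ι) (𝕜 := ℝ)).toAlgEquiv.toLinearMap
  exact L.toContinuousLinearMap.comp_memLp' hpi

lemma toEuclideanCLM_apply_eq_inner (A : Matrix ι ι ℝ) (v : EuclideanSpace ℝ ι) (i : ι) :
    Matrix.toEuclideanCLM (𝕜 := ℝ) A v i = ⟪(WithLp.toLp 2 (A i) : EuclideanSpace ℝ ι), v⟫ := by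
  rw [Matrix.ofLp_toEuclideanCLM, PiLp.inner_apply]
  simp [Matrix.mulVec, dotProduct, mul_comm]

/-- The image `x ↦ ∫ k(x, y) f(y) μ(dy)` of the vector field `f` under the matrix kernel `k`, as a
function defined at every point. -/
def kernelField (μ : Measure α) (k : α → α → Matrix ι ι ℝ) (f : α → EuclideanSpace ℝ ι) (x : α) :
    EuclideanSpace ℝ ι :=
  ∫ y, Matrix.toEuclideanCLM (𝕜 := ℝ) (k x y) (f y) ∂μ

lemma kernelField_apply {k : α → α → Matrix ι ι ℝ} {f : α → EuclideanSpace ℝ ι} {x : α}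
    (hk : ∀ i, MemLp (fun y => (WithLp.toLp 2 (k x y i) : EuclideanSpace ℝ ι)) 2 μ)
    (hf : MemLp f 2 μ) (i : ι) : kernelField μ k f x i
      = ∫ y, ⟪(WithLp.toLp 2 (k x y i) : EuclideanSpace ℝ ι), f y⟫ ∂μ := by
  rw [kernelField, eval_integral_piLp fun i => by
    simp_rw [toEuclideanCLM_apply_eq_inner]
    exact integrable_inner_of_memLp (hk i) hf]
  simp_rw [toEuclideanCLM_apply_eq_inner]

lemma kernelField_congr_ae {k : α → α → Matrix ι ι ℝ} {f g : α → EuclideanSpace ℝ ι}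
    (h : f =ᵐ[μ] g) : kernelField μ k f = kernelField μ k g :=
  funext fun _ => integral_congr_ae (h.mono fun y hy => by simp only [hy])

end MatrixKernel

section SlopeAtZero

variable {α F : Type*} [NormedAddCommGroup F] [NormedSpace ℝ F]

lemma norm_inv_smul_sub_le {u v : F} {b s : ℝ} (hs : s ≠ 0) (h : ‖u - s • v‖ ≤ b * |s|) :
    ‖s⁻¹ • u - v‖ ≤ b := by
  rw [← inv_smul_smul₀ hs v, ← smul_sub, norm_smul, norm_inv, Real.norm_eq_abs,
    inv_mul_le_iff₀ (abs_pos.2 hs), mul_comm]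
  exact h

lemma nonneg_of_isLocalMin_of_hasDerivAt {f f' : ℝ → ℝ} {a x : ℝ} (hmin : IsLocalMin f x)
    (hf : ∀ᶠ t in 𝓝 x, HasDerivAt f (f' t) t) (hf' : HasDerivAt f' a x) : 0 ≤ a := by
  by_contra! ha
  have hderiv₂ : deriv (deriv f) x = a := by
    rw [EventuallyEq.deriv_eq (hf.mono fun t ht => ht.deriv), hf'.deriv]
  have hmax : IsLocalMax f x := isLocalMax_of_deriv_deriv_neg (hderiv₂ ▸ ha) hmin.deriv_eq_zero
    hf.self_of_nhds.continuousAt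
  have hconst : f =ᶠ[𝓝 x] fun _ => f x := by
    filter_upwards [hmin, hmax] with t hle hge
    exact le_antisymm hge hle
  have hderiv₁ : deriv f =ᶠ[𝓝 x] fun _ => 0 :=
    hconst.deriv.trans (Eventually.of_forall fun t => deriv_const t (f x))
  rw [← hderiv₂, hderiv₁.deriv_eq, deriv_const] at ha
  exact lt_irrefl _ ha

lemma continuous_of_expansion [TopologicalSpace α] {g : ℝ → α → F} {g₀ k : α → F} {c : α → ℝ}
    (hg : ∀ s, Continuous (g s)) (hg₀ : Continuous g₀) (hc : Continuous c)
    (h : ∀ᶠ s in 𝓝 (0 : ℝ), ∀ x, ‖g s x - g₀ x - s • k x‖ ≤ c x * s ^ 2) : Continuous k := by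
  have hunif : TendstoLocallyUniformly (fun s x => s⁻¹ • (g s x - g₀ x)) k (𝓝[≠] (0 : ℝ)) := by
    refine Metric.tendstoLocallyUniformly_iff.2 fun ε hε x => ?_
    refine ⟨{y | c y < |c x| + 1}, hc.continuousAt.eventually_lt_const
      ((le_abs_self _).trans_lt (lt_add_one _)), ?_⟩
    filter_upwards [nhdsWithin_le_nhds h, self_mem_nhdsWithin,
      nhdsWithin_le_nhds (eventually_abs_sub_mul_lt 0 (|c x| + 1) hε)] with s hexp hs hsε y hy
    rw [sub_zero] at hsε
    rw [dist_comm, dist_eq_norm]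
    refine (norm_inv_smul_sub_le hs (b := |s| * c y) ((hexp y).trans_eq ?_)).trans_lt ?_
    · rw [← sq_abs]
      ring
    · exact (mul_le_mul_of_nonneg_left (le_of_lt hy) (abs_nonneg s)).trans_lt hsε
  exact hunif.continuous (Frequently.of_forall fun s => ((hg s).sub hg₀).const_smul s⁻¹)

variable {E : Type*} [NormedAddCommGroup E] [NormedSpace ℝ E] [MeasurableSpace E] {μ : Measure E}
  {X : E → E} {g : ℝ → E → F} {g₀ k : E → F} {c : E → ℝ}

lemma eventually_ae_norm_inv_smul_comp_displacement_sub_le (hX : Continuous X)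
    (hXc : HasCompactSupport X) (hg₀ : ContDiff ℝ 1 g₀) (hk : Continuous k) (hc : Continuous c)
    (h : ∀ᶠ s in 𝓝 (0 : ℝ), ∀ x, ‖g s x - g₀ x - s • k x‖ ≤ c x * s ^ 2)
    (hzero : ∀ᵐ x ∂μ, g₀ x = 0) (hderiv : ∀ᵐ x ∂μ, fderiv ℝ g₀ x = 0) {ε : ℝ} (hε : 0 < ε) :
    ∀ᶠ s in 𝓝[≠] (0 : ℝ), ∀ᵐ x ∂μ,
      ‖s⁻¹ • g s (displacement X s x) - k x‖ ≤ ε * (1 + |c x|) := by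
  have hε3 : 0 < ε / 3 := by positivity
  have hk_near := Metric.tendstoUniformly_iff.1
    (tendstoUniformly_comp_displacement hk hX hXc) _ hε3
  have hc_near := Metric.tendstoUniformly_iff.1
    (tendstoUniformly_comp_displacement hc hX hXc) 1 one_pos
  have hg₀_near := eventually_norm_comp_displacement_sub_le hg₀ hX hXc hε3
  filter_upwards [nhdsWithin_le_nhds h, nhdsWithin_le_nhds hk_near, nhdsWithin_le_nhds hc_near,
    nhdsWithin_le_nhds hg₀_near, nhdsWithin_le_nhds (eventually_abs_sub_mul_lt 0 1 hε3),
    self_mem_nhdsWithin] with s hexp hk_near hc_near hg₀_near hsε hs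
  filter_upwards [hzero, hderiv] with x hx hdx
  refine norm_inv_smul_sub_le hs ?_
  set y := displacement X s x
  have hexp_y : ‖g s y - g₀ y - s • k y‖ ≤ (1 + |c x|) * (ε / 3) * |s| := by
    have hcy : c y ≤ 1 + |c x| := by
      have h₁ : dist (c x) (c y) < 1 := hc_near x
      rw [dist_comm, Real.dist_eq] at h₁
      linarith [le_abs_self (c y - c x), le_abs_self (c x)]
    calc ‖g s y - g₀ y - s • k y‖ ≤ c y * |s| ^ 2 := by rw [sq_abs]; exact hexp y
      _ ≤ (1 + |c x|) * |s| ^ 2 := by gcongr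
      _ = (1 + |c x|) * |s| * |s| := by ring
      _ ≤ (1 + |c x|) * (ε / 3) * |s| := by
          gcongr
          simpa using hsε.le
  have hg₀_y : ‖g₀ y‖ ≤ ε / 3 * |s| := by simpa [hx, hdx] using hg₀_near x
  have hk_y : ‖s • (k y - k x)‖ ≤ ε / 3 * |s| := by
    have h₁ : dist (k x) (k y) < ε / 3 := hk_near x
    rw [dist_comm, dist_eq_norm] at h₁
    rw [norm_smul, Real.norm_eq_abs, mul_comm]
    gcongr
  calc ‖g s y - s • k x‖ = ‖(g s y - g₀ y - s • k y) + g₀ y + s • (k y - k x)‖ := by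
        congr 1
        module
    _ ≤ (1 + |c x|) * (ε / 3) * |s| + ε / 3 * |s| + ε / 3 * |s| :=
        norm_add₃_le.trans (by gcongr)
    _ ≤ ε * (1 + |c x|) * |s| := by
        have hcs : 0 ≤ ε * |c x| * |s| := by positivity
        linarith

lemma tendsto_eLpNorm_inv_smul_comp_displacement_sub [IsFiniteMeasure μ] (hX : Continuous X)
    (hXc : HasCompactSupport X) (hg₀ : ContDiff ℝ 1 g₀) (hk : Continuous k) (hc : Continuous c)
    (hcm : MemLp c 2 μ)
    (h : ∀ᶠ s in 𝓝 (0 : ℝ), ∀ x, ‖g s x - g₀ x - s • k x‖ ≤ c x * s ^ 2)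
    (hzero : ∀ᵐ x ∂μ, g₀ x = 0) (hderiv : ∀ᵐ x ∂μ, fderiv ℝ g₀ x = 0) :
    Tendsto (fun s => eLpNorm (fun x => s⁻¹ • g s (displacement X s x) - k x) 2 μ)
      (𝓝[≠] 0) (𝓝 0) := by
  have hbound : MemLp (fun x => 1 + |c x|) 2 μ := (memLp_const (1 : ℝ)).add hcm.norm
  have hlim : Tendsto (fun ε => ENNReal.ofReal ε * eLpNorm (fun x => 1 + |c x|) 2 μ)
      (𝓝[>] 0) (𝓝 0) := by
    simpa using (ENNReal.Tendsto.mul_const (ENNReal.tendsto_ofReal tendsto_id)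
      (Or.inr hbound.2.ne)).mono_left (nhdsWithin_le_nhds (a := (0 : ℝ)) (s := Set.Ioi 0))
  refine ENNReal.tendsto_nhds_zero.2 fun η hη => ?_
  obtain ⟨ε, hεη, hε⟩ := ((ENNReal.tendsto_nhds_zero.1 hlim η hη).and self_mem_nhdsWithin).exists
  filter_upwards [eventually_ae_norm_inv_smul_comp_displacement_sub_le hX hXc hg₀ hk hc h hzero
    hderiv hε] with s hs
  refine (eLpNorm_le_mul_eLpNorm_of_ae_le_mul ?_ 2).trans hεη
  filter_upwards [hs] with x hx
  exact hx.trans (mul_le_mul_of_nonneg_left (Real.le_norm_self _) hε.le)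

end SlopeAtZero

lemma tendsto_integral_inner_of_tendsto_eLpNorm {α ι E : Type*} [MeasurableSpace α]
    {μ : Measure α} [NormedAddCommGroup E] [InnerProductSpace ℝ E] {l : Filter ι}
    {u : ι → α → E} {k n : α → E} (hu : ∀ i, MemLp (u i) 2 μ) (hk : MemLp k 2 μ)
    (hn : MemLp n 2 μ) (h : Tendsto (fun i => eLpNorm (fun x => u i x - k x) 2 μ) l (𝓝 0)) :
    Tendsto (fun i => ∫ x, ⟪u i x, n x⟫ ∂μ) l (𝓝 (∫ x, ⟪k x, n x⟫ ∂μ)) := by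
  have hlim : Tendsto (fun i => eLpNorm (fun x => u i x - k x) 2 μ * eLpNorm n 2 μ) l (𝓝 0) := by
    simpa using ENNReal.Tendsto.mul_const h (Or.inr hn.2.ne)
  refine tendsto_iff_edist_tendsto_0.2
    (tendsto_of_tendsto_of_tendsto_of_le_of_le tendsto_const_nhds hlim (fun _ => zero_le)
      fun i => ?_)
  simp only
  rw [edist_eq_enorm_sub,
    ← integral_sub (integrable_inner_of_memLp (hu i) hn) (integrable_inner_of_memLp hk hn)]
  simp_rw [← inner_sub_left]
  exact enorm_integral_bilin_le (b := fun u v => ⟪u, v⟫) norm_inner_le_norm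
    ((hu i).sub hk).1 hn.1

section SecondOrder

variable {d : ℕ} {F : P2 d → ℝ} {G : P2 d → Eu d → Eu d}
  {k : Eu d → Eu d → Matrix (Fin d) (Fin d) ℝ} {μ : P2 d} {φ : Eu d → ℝ}

/-- `k` is the Wasserstein Hessian kernel at `μ` of a functional with Wasserstein gradient `G`:
the components of `ν ↦ G ν x` have the rows of `k x` as Wasserstein gradients at `μ`, with an error
that is square integrable and locally bounded in `x`. -/
def IsHessianKernel (G : P2 d → Eu d → Eu d) (μ : P2 d)
    (k : Eu d → Eu d → Matrix (Fin d) (Fin d) ℝ) : Prop :=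
  ∃ (c : Eu d → ℝ) (r : ℝ), Continuous c ∧ MemLp c 2 μ.meas ∧ 0 < r ∧ ∀ (x : Eu d) (i : Fin d),
    IsWGradientWith (fun ν => G ν x i) μ (fun y => WithLp.toLp 2 (k x y i)) (c x) r

lemma IsHessianKernel.inTangent (hk : IsHessianKernel G μ k) (x : Eu d) (i : Fin d) :
    InTangent μ fun y => WithLp.toLp 2 (k x y i) := by
  obtain ⟨_, _, _, _, _, h⟩ := hk
  exact (h x i).1

lemma norm_le_card_mul {ι : Type*} [Fintype ι] {v : EuclideanSpace ℝ ι} {a : ℝ}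
    (h : ∀ i, |v i| ≤ a) : ‖v‖ ≤ Fintype.card ι * a := by
  classical
  rw [← (EuclideanSpace.basisFun ι ℝ).sum_repr v]
  refine (norm_sum_le_of_le Finset.univ (f := fun i => v i • EuclideanSpace.basisFun ι ℝ i)
    fun i _ => ?_).trans_eq ?_ (b := ∑ _i : ι, a)
  · simpa [norm_smul] using h i
  · simp

lemma IsHessianKernel.exists_expansion (hk : IsHessianKernel G μ k) (hφ : IsTestFunction φ) :
    ∃ c : Eu d → ℝ, Continuous c ∧ MemLp c 2 μ.meas ∧ ∀ᶠ s in 𝓝 (0 : ℝ), ∀ x,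
      ‖G (μ.displace hφ.memLp_gradient s) x - G μ x - s • kernelField μ.meas k (gradient φ) x‖
        ≤ c x * s ^ 2 := by
  obtain ⟨c, r, hc, hcm, hr, hrow⟩ := id hk
  obtain ⟨L, hL⟩ := hφ.exists_lipschitzWith_gradient
  set A := ∫ x, ‖gradient φ x‖ ^ 2 ∂μ.meas
  refine ⟨fun x => d * A * c x, continuous_const.mul hc, hcm.const_mul _, ?_⟩
  filter_upwards [eventually_abs_mul_le (s := 0) (L := L) (by simp),
    eventually_abs_sub_mul_lt 0 (√A) hr] with s hs hsr x
  have hcomponent (i : Fin d) : |(G (μ.displace hφ.memLp_gradient s) x - G μ x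
      - s • kernelField μ.meas k (gradient φ) x) i| ≤ c x * A * s ^ 2 := by
    have h₀ : IsWGradientWith (fun ν => G ν x i) (μ.displace hφ.memLp_gradient 0)
        (fun y => WithLp.toLp 2 (k x y i)) (c x) r := by
      rw [P2.displace_zero]
      exact hrow x i
    have hle := h₀.abs_displace_sub_le hφ hL (by simp) hs hsr
    rw [P2.displace_zero, displacement_zero, sub_zero] at hle
    simpa [kernelField_apply (fun i => (hk.inTangent x i).1) hφ.memLp_gradient] using hle
  refine (norm_le_card_mul hcomponent).trans_eq ?_
  rw [Fintype.card_fin]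
  ring

/-- The quotients `G(μ_s, x + s ∇φ(x)) / s` of the gradient along the displacement `μ_s` of `μ` by
`∇φ`. They are difference quotients at `s = 0` wherever `G(μ, x) = 0`. -/
def gradientQuotient (G : P2 d → Eu d → Eu d) (μ : P2 d) (hφ : IsTestFunction φ) (s : ℝ)
    (x : Eu d) : Eu d :=
  s⁻¹ • G (μ.displace hφ.memLp_gradient s) (displacement (gradient φ) s x)

lemma memLp_gradientQuotient (htan : ∀ ν, InTangent ν (G ν)) (hφ : IsTestFunction φ) (s : ℝ) :
    MemLp (gradientQuotient G μ hφ s) 2 μ.meas :=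
  ((htan _).1.comp_measurePreserving (measurePreserving_displacement hφ.memLp_gradient
    hφ.contDiff_gradient.continuous.measurable s)).const_smul s⁻¹

lemma IsHessianKernel.tendsto_integral_inner (hk : IsHessianKernel G μ k)
    (htan : ∀ ν, InTangent ν (G ν)) (hcont : ∀ ν, Continuous (G ν)) (hC1 : ContDiff ℝ 1 (G μ))
    (hzero : ∀ᵐ x ∂μ.meas, G μ x = 0) (hderiv : ∀ᵐ x ∂μ.meas, fderiv ℝ (G μ) x = 0)
    (hφ : IsTestFunction φ) (hkm : MemLp (kernelField μ.meas k (gradient φ)) 2 μ.meas)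
    {n : Eu d → Eu d} (hn : MemLp n 2 μ.meas) :
    Tendsto (fun s => ∫ x, ⟪gradientQuotient G μ hφ s x, n x⟫ ∂μ.meas) (𝓝[≠] 0)
      (𝓝 (∫ x, ⟪kernelField μ.meas k (gradient φ) x, n x⟫ ∂μ.meas)) := by
  obtain ⟨c, hc, hcm, hexp⟩ := hk.exists_expansion hφ
  have hX := hφ.contDiff_gradient.continuous
  exact tendsto_integral_inner_of_tendsto_eLpNorm (memLp_gradientQuotient htan hφ) hkm hn
    (tendsto_eLpNorm_inv_smul_comp_displacement_sub hX hφ.hasCompactSupport_gradient hC1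
      (continuous_of_expansion (fun s => hcont _) (hcont μ) hc hexp) hc hcm hexp hzero hderiv)

lemma IsW2LocalMin.nonneg_of_tendsto (hmin : IsW2LocalMin F μ) (hgrad : ∀ ν, IsWGradient F ν (G ν))
    (hφ : IsTestFunction φ) {a : ℝ}
    (hlim : Tendsto (fun s => ∫ x, ⟪gradientQuotient G μ hφ s x, gradient φ x⟫ ∂μ.meas)
      (𝓝[≠] 0) (𝓝 a)) : 0 ≤ a := by
  obtain ⟨L, hL⟩ := hφ.exists_lipschitzWith_gradient
  have hf : ∀ᶠ s in 𝓝 (0 : ℝ), HasDerivAt (fun t => F (μ.displace hφ.memLp_gradient t))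
      (∫ x, ⟪G (μ.displace hφ.memLp_gradient s) (displacement (gradient φ) s x),
        gradient φ x⟫ ∂μ.meas) s := by
    have hsmall : ∀ᶠ s in 𝓝 (0 : ℝ), |s| * (L : ℝ) < 1 / 8 := by
      simpa using eventually_abs_sub_mul_lt (0 : ℝ) (L : ℝ) (r := 1 / 8) (by norm_num)
    filter_upwards [hsmall] with s hs
    exact (hgrad _).hasDerivAt_displace hφ hL hs
  have hcrit := (hmin.isLocalMin_displace hφ).hasDerivAt_eq_zero hf.self_of_nhds
  refine nonneg_of_isLocalMin_of_hasDerivAt (hmin.isLocalMin_displace hφ) hf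
    (hasDerivAt_iff_tendsto_slope_zero.2 ?_)
  simpa only [zero_add, hcrit, sub_zero, smul_eq_mul, gradientQuotient, real_inner_smul_left,
    integral_const_mul] using hlim

lemma InTangent.integral_inner_fderiv_displacement_eq_zero {ξ n : Eu d → Eu d} {s : ℝ}
    (hφ : IsTestFunction φ) (hξ : InTangent (μ.displace hφ.memLp_gradient s) ξ)
    (hn : MemLp (fun x => fderiv ℝ (displacement (gradient φ) s) x (n x)) 2 μ.meas)
    (horth : ∀ ψ, IsTestFunction ψ → ∫ x, ⟪gradient ψ x, n x⟫ ∂μ.meas = 0) :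
    ∫ x, ⟪ξ (displacement (gradient φ) s x),
      fderiv ℝ (displacement (gradient φ) s) x (n x)⟫ ∂μ.meas = 0 := by
  refine hξ.integral_inner_comp_eq_zero (measurePreserving_displacement hφ.memLp_gradient
    hφ.contDiff_gradient.continuous.measurable s) hn fun ψ hψ => ?_
  rw [← horth _ (hψ.comp_displacement hφ.contDiff_gradient hφ.hasCompactSupport_gradient s)]
  exact integral_congr_ae (ae_of_all _ fun x => (inner_gradient_comp (hψ.differentiable _)
    ((contDiff_displacement hφ.contDiff_gradient s).differentiable (by simp) x) (n x)).symm)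

lemma memLp_fderiv_apply {E F : Type*} [NormedAddCommGroup E] [NormedSpace ℝ E]
    [NormedAddCommGroup F] [NormedSpace ℝ F] [MeasurableSpace E] [OpensMeasurableSpace E]
    [SecondCountableTopologyEither E (E →L[ℝ] F)] {μ : Measure E} {p : ℝ≥0∞} {f : E → F}
    (hf : ContDiff ℝ 1 f) (hc : HasCompactSupport f) {n : E → E} (hn : MemLp n p μ) :
    MemLp (fun x => fderiv ℝ f x (n x)) p μ := by
  have hcont := hf.continuous_fderiv one_ne_zero
  obtain ⟨B, hB⟩ := (hc.fderiv ℝ).exists_bound_of_continuous hcont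
  refine MemLp.of_le_mul (c := B) hn ?_ (ae_of_all _ fun x => ?_)
  · exact (ContinuousLinearMap.apply ℝ F).aestronglyMeasurable_comp₂ hn.1
      hcont.aestronglyMeasurable
  · exact ((fderiv ℝ f x).le_opNorm _).trans (by gcongr; exact hB x)

lemma integral_inner_eq_zero_of_tendsto (htan : ∀ ν, InTangent ν (G ν)) (hφ : IsTestFunction φ)
    {V n : Eu d → Eu d} (hn : MemLp n 2 μ.meas)
    (horth : ∀ ψ, IsTestFunction ψ → ∫ x, ⟪gradient ψ x, n x⟫ ∂μ.meas = 0)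
    (hlim : ∀ m, MemLp m 2 μ.meas → Tendsto (fun s => ∫ x, ⟪gradientQuotient G μ hφ s x, m x⟫
      ∂μ.meas) (𝓝[≠] 0) (𝓝 (∫ x, ⟪V x, m x⟫ ∂μ.meas))) :
    ∫ x, ⟪V x, n x⟫ ∂μ.meas = 0 := by
  set N : Eu d → Eu d := fun x => fderiv ℝ (gradient φ) x (n x)
  have hX : ContDiff ℝ 1 (gradient φ) := hφ.contDiff_gradient.of_le (by simp)
  have hN : MemLp N 2 μ.meas := memLp_fderiv_apply hX hφ.hasCompactSupport_gradient hn
  have hfderiv (s : ℝ) : (fun x => fderiv ℝ (displacement (gradient φ) s) x (n x))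
      = fun x => n x + s • N x := by
    ext1 x
    rw [(hasFDerivAt_displacement (hX.differentiable one_ne_zero x) s).fderiv]
    rfl
  have hu := memLp_gradientQuotient (μ := μ) htan hφ
  have hpullback (s : ℝ) : ∫ x, ⟪gradientQuotient G μ hφ s x, n x⟫ ∂μ.meas
      + s * ∫ x, ⟪gradientQuotient G μ hφ s x, N x⟫ ∂μ.meas = 0 := by
    have hdisplaced := (htan _).integral_inner_fderiv_displacement_eq_zero hφ (s := s)
      (hfderiv s ▸ hn.add (hN.const_smul s)) horth
    rw [← integral_const_mul, ← integral_add (integrable_inner_of_memLp (hu s) hn)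
      ((integrable_inner_of_memLp (hu s) hN).const_mul s)]
    simp_rw [← real_inner_smul_right, ← inner_add_right, gradientQuotient, real_inner_smul_left]
    rw [integral_const_mul]
    simp only [congrFun (hfderiv s)] at hdisplaced
    rw [hdisplaced, mul_zero]
  have hsum := (hlim n hn).add ((tendsto_id.mono_left nhdsWithin_le_nhds).mul (hlim N hN))
  rw [zero_mul, add_zero] at hsum
  exact tendsto_nhds_unique hsum (tendsto_const_nhds.congr fun s => (hpullback s).symm)

end SecondOrder

section Operator

lemma inner_apply_nonneg_of_mapsTo_topologicalClosure {V : Type*} [NormedAddCommGroup V]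
    [InnerProductSpace ℝ V] [CompleteSpace V] {W : Submodule ℝ V} {H : V →L[ℝ] V}
    (hpos : ∀ t ∈ W, 0 ≤ ⟪t, H t⟫) (hmaps : ∀ t ∈ W, H t ∈ W.topologicalClosure)
    (hker : ∀ n ∈ Wᗮ, H n = 0) (v : V) : 0 ≤ ⟪v, H v⟫ := by
  have hpos_closure : ∀ t ∈ W.topologicalClosure, 0 ≤ ⟪t, H t⟫ := fun t ht =>
    closure_minimal (t := {t | 0 ≤ ⟪t, H t⟫}) hpos
      (isClosed_le continuous_const (continuous_id.inner H.continuous)) ht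
  have hmaps_closure : W.topologicalClosure ≤ W.topologicalClosure.comap H.toLinearMap :=
    W.topologicalClosure_minimal hmaps (W.isClosed_topologicalClosure.preimage H.continuous)
  have : CompleteSpace W.topologicalClosure := W.isClosed_topologicalClosure.completeSpace_coe
  obtain ⟨t, ht, n, hn, rfl⟩ := W.topologicalClosure.exists_add_mem_mem_orthogonal v
  have hHt : H t ∈ W.topologicalClosure := hmaps_closure ht
  rw [map_add, hker n (W.orthogonal_closure ▸ hn), add_zero, inner_add_left,
    Submodule.inner_left_of_mem_orthogonal hHt hn, add_zero]
  exact hpos_closure t ht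

variable {d : ℕ} {F : P2 d → ℝ} {G : P2 d → Eu d → Eu d}
  {k : Eu d → Eu d → Matrix (Fin d) (Fin d) ℝ} {μ : P2 d}
  {H : Lp (Eu d) 2 μ.meas →L[ℝ] Lp (Eu d) 2 μ.meas}

/-- The gradients of test functions, as a subspace of `L²(μ; ℝ^d)`; the tangent space at `μ` is its
closure. -/
def testGradients (μ : P2 d) : Submodule ℝ (Lp (Eu d) 2 μ.meas) where
  carrier := {f | ∃ φ : Eu d → ℝ, IsTestFunction φ ∧ f =ᵐ[μ.meas] gradient φ}
  zero_mem' := by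
    refine ⟨0, IsTestFunction.zero, (Lp.coeFn_zero (Eu d) 2 μ.meas).trans (ae_of_all _ fun x => ?_)⟩
    simp [gradient]
  add_mem' := by
    rintro f g ⟨φ, hφ, hf⟩ ⟨ψ, hψ, hg⟩
    refine ⟨φ + ψ, hφ.add hψ, ?_⟩
    rw [gradient_add hφ.differentiable hψ.differentiable]
    exact (Lp.coeFn_add f g).trans (hf.add hg)
  smul_mem' := by
    rintro a f ⟨φ, hφ, hf⟩
    refine ⟨a • φ, hφ.const_smul a, ?_⟩
    rw [gradient_const_smul hφ.differentiable]
    exact (Lp.coeFn_smul a f).trans (hf.const_smul a)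

lemma integral_inner_gradient_eq_zero {n : Lp (Eu d) 2 μ.meas} (hn : n ∈ (testGradients μ)ᗮ)
    {ψ : Eu d → ℝ} (hψ : IsTestFunction ψ) : ∫ x, ⟪gradient ψ x, n x⟫ ∂μ.meas = 0 := by
  have hgrad := (hψ.memLp_gradient (p := 2) (μ := μ.meas)).coeFn_toLp
  rw [← hn _ ⟨ψ, hψ, hgrad⟩, L2.inner_def]
  exact integral_congr_ae (hgrad.mono fun x hx => by simp only [hx])

lemma IsHessianKernel.apply_eq_zero (hk : IsHessianKernel G μ k) (hH : IsIntegralOperator μ k H)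
    {n : Lp (Eu d) 2 μ.meas} (hn : n ∈ (testGradients μ)ᗮ) : H n = 0 := by
  refine Lp.ext ((hH n).trans (EventuallyEq.trans (ae_of_all _ fun x => ?_)
    (Lp.coeFn_zero (Eu d) 2 μ.meas).symm))
  ext i
  refine (kernelField_apply (fun i => (hk.inTangent x i).1) (Lp.memLp n) i).trans ?_
  exact (hk.inTangent x i).integral_inner_comp_eq_zero (.id _) (Lp.memLp n)
    fun ψ hψ => integral_inner_gradient_eq_zero hn hψ

lemma IsIntegralOperator.ae_eq_kernelField (hH : IsIntegralOperator μ k H)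
    {f : Lp (Eu d) 2 μ.meas} {g : Eu d → Eu d} (hf : f =ᵐ[μ.meas] g) :
    H f =ᵐ[μ.meas] kernelField μ.meas k g :=
  (hH f).trans (EventuallyEq.of_eq (kernelField_congr_ae hf))

lemma IsHessianKernel.tendsto_integral_inner_apply (hk : IsHessianKernel G μ k)
    (hgrad : ∀ ν, IsWGradient F ν (G ν)) (hcont : ∀ ν, Continuous (G ν))
    (hC1 : ContDiff ℝ 1 (G μ)) (hac : μ.meas ≪ volume) (hmin : IsW2LocalMin F μ)
    (hH : IsIntegralOperator μ k H) {φ : Eu d → ℝ} (hφ : IsTestFunction φ)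
    {t : Lp (Eu d) 2 μ.meas} (ht : t =ᵐ[μ.meas] gradient φ) {n : Eu d → Eu d}
    (hn : MemLp n 2 μ.meas) :
    Tendsto (fun s => ∫ x, ⟪gradientQuotient G μ hφ s x, n x⟫ ∂μ.meas) (𝓝[≠] 0)
      (𝓝 (∫ x, ⟪H t x, n x⟫ ∂μ.meas)) := by
  have hHt := hH.ae_eq_kernelField ht
  have hzero := hmin.ae_eq_zero (hgrad μ)
  rw [integral_congr_ae (hHt.mono fun x hx => by rw [hx])]
  exact hk.tendsto_integral_inner (fun ν => (hgrad ν).inTangent) hcont hC1 hzero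
    (ae_fderiv_eq_zero hac (hC1.differentiable one_ne_zero) hzero) hφ
    ((memLp_congr_ae hHt).1 (Lp.memLp _)) hn

lemma IsHessianKernel.inner_apply_nonneg (hk : IsHessianKernel G μ k)
    (hgrad : ∀ ν, IsWGradient F ν (G ν)) (hcont : ∀ ν, Continuous (G ν))
    (hC1 : ContDiff ℝ 1 (G μ)) (hac : μ.meas ≪ volume) (hmin : IsW2LocalMin F μ)
    (hH : IsIntegralOperator μ k H) {t : Lp (Eu d) 2 μ.meas} (ht : t ∈ testGradients μ) :
    0 ≤ ⟪t, H t⟫ := by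
  obtain ⟨φ, hφ, hφt⟩ := ht
  refine (hmin.nonneg_of_tendsto hgrad hφ (hk.tendsto_integral_inner_apply hgrad hcont hC1 hac
    hmin hH hφ hφt hφ.memLp_gradient)).trans_eq ?_
  rw [real_inner_comm, L2.inner_def]
  exact integral_congr_ae (hφt.mono fun x hx => by simp only [hx])

lemma IsHessianKernel.apply_mem_topologicalClosure (hk : IsHessianKernel G μ k)
    (hgrad : ∀ ν, IsWGradient F ν (G ν)) (hcont : ∀ ν, Continuous (G ν))
    (hC1 : ContDiff ℝ 1 (G μ)) (hac : μ.meas ≪ volume) (hmin : IsW2LocalMin F μ)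
    (hH : IsIntegralOperator μ k H) {t : Lp (Eu d) 2 μ.meas} (ht : t ∈ testGradients μ) :
    H t ∈ (testGradients μ).topologicalClosure := by
  obtain ⟨φ, hφ, hφt⟩ := ht
  rw [← Submodule.orthogonal_orthogonal_eq_closure]
  refine fun n hn => ?_
  rw [real_inner_comm, L2.inner_def]
  exact integral_inner_eq_zero_of_tendsto (fun ν => (hgrad ν).inTangent) hφ (Lp.memLp n)
    (fun ψ hψ => integral_inner_gradient_eq_zero hn hψ)
    fun m hm => hk.tendsto_integral_inner_apply hgrad hcont hC1 hac hmin hH hφ hφt hm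

end Operator

end WassersteinOpt

end

theorem mainTheorem5_general {d : ℕ} (F : WassersteinOpt.P2 d → ℝ)
    (G : WassersteinOpt.P2 d → WassersteinOpt.Eu d → WassersteinOpt.Eu d)
    (μ : WassersteinOpt.P2 d)
    (k : WassersteinOpt.Eu d → WassersteinOpt.Eu d → Matrix (Fin d) (Fin d) ℝ)
    (hgrad : ∀ ν, WassersteinOpt.IsWGradient F ν (G ν)) (hcont : ∀ ν, Continuous (G ν))
    (hC1 : ContDiff ℝ 1 (G μ)) (hk : WassersteinOpt.IsHessianKernel G μ k)
    (hkL2 : ∀ i j, MemLp (fun p : WassersteinOpt.Eu d × WassersteinOpt.Eu d => k p.1 p.2 i j) 2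
      (μ.meas.prod μ.meas))
    (hac : μ.meas ≪ volume) (hmin : WassersteinOpt.IsW2LocalMin F μ) :
    ∃ H : Lp (WassersteinOpt.Eu d) 2 μ.meas →L[ℝ] Lp (WassersteinOpt.Eu d) 2 μ.meas,
      WassersteinOpt.IsIntegralOperator μ k H ∧ ∀ v, 0 ≤ ⟪v, H v⟫ := by
  obtain ⟨H, hH⟩ := WassersteinOpt.exists_integralOperator
    (WassersteinOpt.memLp_toEuclideanCLM hkL2)
  refine ⟨H, hH, WassersteinOpt.inner_apply_nonneg_of_mapsTo_topologicalClosure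
    (W := WassersteinOpt.testGradients μ) ?_ ?_ ?_⟩
  · exact fun t ht => hk.inner_apply_nonneg hgrad hcont hC1 hac hmin hH ht
  · exact fun t ht => hk.apply_mem_topologicalClosure hgrad hcont hC1 hac hmin hH ht
  · exact fun n hn => hk.apply_eq_zero hH hn

theorem mainTheorem5 {d : ℕ} (F : WassersteinOpt.P2 d → ℝ)
    (G : WassersteinOpt.P2 d → WassersteinOpt.Eu d → WassersteinOpt.Eu d)
    (K : WassersteinOpt.P2 d → WassersteinOpt.Eu d → WassersteinOpt.Eu d →
      Matrix (Fin d) (Fin d) ℝ)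
    (hF : WassersteinOpt.SufficientlySmooth F G K)
    (μ : WassersteinOpt.P2 d) (hac : μ.meas ≪ volume)
    (hmin : WassersteinOpt.IsW2LocalMin F μ) :
    ∃ H : Lp (WassersteinOpt.Eu d) 2 μ.meas →L[ℝ] Lp (WassersteinOpt.Eu d) 2 μ.meas,
      WassersteinOpt.IsIntegralOperator μ (K μ) H ∧ ∀ v, 0 ≤ ⟪v, H v⟫ :=
  mainTheorem5_general F G μ (K μ) hF.grad (fun ν => (hF.contDiff ν).continuous) (hF.contDiff μ)
    (hF.hess μ) (hF.hess_memLp μ) hac hmin
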